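/- **Setting.** Let $2\le m\le K$ and $T\ge 1$. A preference matrix is a $P\in[0,1]^{K\times K}$ with $P(i,j)+P(j,i)=1$ and $P(i,i)=\tfrac12$. An oblivious adversary fixes preference matrices $P_1,\dots,P_T$ such that some arm $a^\star$ satisfies $P_t(a^\star,i)\ge\tfrac12$ for all $i\in[K]$ and $t\in[T]$. When a tuple $\mathcal A\in[K]^m$ is played in round $t$, index $i\in[m]$ wins with probability $\sum_{j\ne i}\frac{2P_t(\mathcal A(i),\mathcal A(j))}{m(m-1)}$. Put $\Delta_t(i)=P_t(a^\star,i)-\tfrac12$ and let $R_T^{\mathrm C}=\sum_{t=1}^T\frac1m\sum_{j=1}^m\Delta_t(\mathcal A_t(j))$ be the Condorcet pseudo-regret. Let $\beta_m=\frac{m}{2(m-1)}$ for even $m$ and $\beta_m=\frac{m+1}{2m}$ for odd $m$; let $\alpha_m=\frac{1-\beta_m}2$, $\widehat P_t=\alpha_m+\beta_mP_t$, and $\widehat\Delta_t(i)=\widehat P_t(a^\star,i)-\tfrac12$. **Algorithm (MetaDueling with Versatile-DB).** In round $t$ draw $x_t\sim p_{+1,t}$ and $y_t\sim p_{-1,t}$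 independently, and an independent fair coin. Fill the first $n_x$ of $m$ slots with $x_t$ and the others with $y_t$, where $n_x=m/2$ if $m$ is even, and $n_x=\lceil m/2\rceil$ or $\lfloor m/2\rfloor$ according to the coin if $m$ is odd. Play this tuple, observe the winning index $I_t$, and set $o_t=\mathbf 1[I_t\le n_x]$, i.e. $o_t=1$ when one of the slots filled for $x_t$ wins. The two distributions are $$p_{\pm1,t}=\operatorname*{arg\,min}_{p\in\Delta_K}\Big\{\sum_{k}p(k)\sum_{s<t}\hat\ell_{\pm1,s}(k)-\frac{4}{\eta_t}\sum_k\sqrt{p(k)}\Big\},\qquad \eta_t=\frac{2}{\sqrt t},$$ where $\Delta_K$ is the probability simplex, $\hat\ell_{+1,s}(k)=\frac{\mathbf 1[x_s=k]\,(1-o_s)}{p_{+1,s}(k)}$ and $\hat\ell_{-1,s}(k)=\frac{\mathbf 1[y_s=k]\,o_s}{p_{-1,s}(k)}$. The algorithm does not depend on $T$, $(P_t)$, $a^\star$, or the regime. **Theorem.** In this setting the following hold simultaneously. (i) $\displaystyle \mathbb E[R_T^{\mathrm C}]\le\frac1{\beta_m}\left(4\sqrt{KT}+1\right)\le 8\sqrt{KT}+2.$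 (ii) Let $\Delta_i>0$ $(i\neq a^\star)$ be any numbers such that, with $\widehat\Delta_i=\beta_m\Delta_i$, the self-bounding condition $$\mathbb E\Big[\sum_{t=1}^T\tfrac12\big(\widehat\Delta_t(x_t)+\widehat\Delta_t(y_t)\big)\Big]\ \ge\ \frac12\,\mathbb E\Big[\sum_{t=1}^T\sum_{i\ne a^\star}\big(p_{+1,t}(i)+p_{-1,t}(i)\big)\widehat\Delta_i\Big]$$ holds. Then $$\mathbb E[R_T^{\mathrm C}]\le\frac1{\beta_m^2}\sum_{i\ne a^\star}\frac{16\log T+48}{\Delta_i}+\frac{4\log T+12}{\beta_m}+\frac{8\sqrt K}{\beta_m}.$$ -/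

import Mathlib

open scoped BigOperators

namespace MultiDueling

noncomputable section

/-- A preference matrix on `K` arms: `pref i j` is the probability that `i` beats `j`. -/
structure PreferenceMatrix (K : ℕ) where
  pref : Fin K → Fin K → ℝ
  mem_unit : ∀ i j, pref i j ∈ Set.Icc (0 : ℝ) 1
  reciprocal : ∀ i j, pref i j + pref j i = 1
  self_comparison : ∀ i, pref i i = 1 / 2

/-- The expectation of a real function under a law on a finite type. -/
def expectation {α : Type*} [Fintype α] (μ : PMF α) (f : α → ℝ) : ℝ :=
  ∑ a, (μ a).toReal * f a

/-! ### The choice model -/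

/-- Pairwise-subset choice model: the probability that index `i` of the multiset `A` wins. -/
def winProb {K m : ℕ} (P : PreferenceMatrix K) (A : Fin m → Fin K) (i : Fin m) : ℝ :=
  ∑ j ∈ Finset.univ.erase i, 2 * P.pref (A i) (A j) / ((m : ℝ) * ((m : ℝ) - 1))

theorem winProb_nonneg {K m : ℕ} (hm : 2 ≤ m) (P : PreferenceMatrix K) (A : Fin m → Fin K)
    (i : Fin m) : 0 ≤ winProb P A i := by
  have h2 : (2 : ℝ) ≤ m := by exact_mod_cast hm
  refine Finset.sum_nonneg fun j _ => div_nonneg ?_ ?_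
  · linarith [(P.mem_unit (A i) (A j)).1]
  · exact mul_nonneg (by linarith) (by linarith)

theorem sum_winProb {K m : ℕ} (hm : 2 ≤ m) (P : PreferenceMatrix K) (A : Fin m → Fin K) :
    ∑ i, winProb P A i = 1 := by
  have h2 : (2 : ℝ) ≤ m := by exact_mod_cast hm
  have hm0 : (m : ℝ) ≠ 0 := by linarith
  have hm1 : (m : ℝ) - 1 ≠ 0 := by linarith
  have hfull : ∑ i : Fin m, ∑ j : Fin m, P.pref (A i) (A j) = (m : ℝ) * m / 2 := by
    have hs : ∑ i : Fin m, ∑ j : Fin m, P.pref (A i) (A j)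
        = ∑ i : Fin m, ∑ j : Fin m, P.pref (A j) (A i) := Finset.sum_comm
    have ht : ∑ i : Fin m, ∑ j : Fin m, P.pref (A i) (A j)
        + ∑ i : Fin m, ∑ j : Fin m, P.pref (A j) (A i) = (m : ℝ) * m := by
      simp_rw [← Finset.sum_add_distrib, P.reciprocal]
      simp
    linarith
  have hrow : ∀ i : Fin m, winProb P A i
      = (2 / ((m : ℝ) * ((m : ℝ) - 1))) * ((∑ j, P.pref (A i) (A j)) - 1 / 2) := by
    intro i
    have he : ∑ j ∈ Finset.univ.erase i, P.pref (A i) (A j)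
        = (∑ j, P.pref (A i) (A j)) - 1 / 2 := by
      rw [← Finset.add_sum_erase Finset.univ _ (Finset.mem_univ i), P.self_comparison]
      ring
    rw [← he, winProb, Finset.mul_sum]
    exact Finset.sum_congr rfl fun j _ => by ring
  simp_rw [hrow]
  rw [← Finset.mul_sum, Finset.sum_sub_distrib, hfull]
  simp only [Finset.sum_const, Finset.card_univ, Fintype.card_fin, nsmul_eq_mul]
  field_simp

/-- The law of the winning index. -/
def winnerLaw {K m : ℕ} (hm : 2 ≤ m) (P : PreferenceMatrix K) (A : Fin m → Fin K) :
    PMF (Fin m) :=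
  PMF.ofFintype (fun i => ENNReal.ofReal (winProb P A i)) (by
    rw [← ENNReal.ofReal_sum_of_nonneg fun i _ => winProb_nonneg hm P A i, sum_winProb hm]
    simp)

/-- The law of an arm drawn from a point of the probability simplex. -/
def armLaw {K : ℕ} (q : stdSimplex ℝ (Fin K)) : PMF (Fin K) :=
  PMF.ofFintype (fun i => ENNReal.ofReal (q.1 i)) (by
    rw [← ENNReal.ofReal_sum_of_nonneg fun i _ => q.2.1 i, q.2.2]
    simp)

/-! ### Dueling bandit algorithms -/

/-- What a dueling bandit algorithm sees in one round: the two arms `(x, y)` and the binary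
outcome, `true` meaning that `x` won. -/
abbrev DuelRecord (K : ℕ) : Type := Fin K × Fin K × Bool

/-- A dueling bandit algorithm draws the two arms independently from two distributions that are
functions of the records of the `t` earlier rounds. -/
structure DuelingAlgorithm (K : ℕ) where
  first : (t : ℕ) → (Fin t → DuelRecord K) → stdSimplex ℝ (Fin K)
  second : (t : ℕ) → (Fin t → DuelRecord K) → stdSimplex ℝ (Fin K)

/-! ### The base algorithm: two copies of Tsallis-INF, one for each of the two arms -/

/-- The objective of the regularized leader after `t` rounds, that is, in round `t + 1`: with the
learning rate `2 / √(t + 1)`, the linear loss minus `(4 / learning rate) * ∑ √(w k)`. -/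
def tsallisObjective {K : ℕ} (t : ℕ) (L : Fin K → ℝ) (w : Fin K → ℝ) : ℝ :=
  ∑ k, w k * L k - 4 / (2 / Real.sqrt (t + 1)) * ∑ k, Real.sqrt (w k)

theorem exists_tsallis_min {K : ℕ} [NeZero K] (t : ℕ) (L : Fin K → ℝ) :
    ∃ w ∈ stdSimplex ℝ (Fin K), IsMinOn (tsallisObjective t L) (stdSimplex ℝ (Fin K)) w := by
  refine (isCompact_stdSimplex ℝ (Fin K)).exists_isMinOn ?_ ?_
  · exact ⟨_, single_mem_stdSimplex ℝ (0 : Fin K)⟩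
  · unfold tsallisObjective
    fun_prop

/-- The minimizer of the objective over the simplex (it is unique by strict convexity). -/
def tsallisDist {K : ℕ} [NeZero K] (t : ℕ) (L : Fin K → ℝ) : stdSimplex ℝ (Fin K) :=
  ⟨(exists_tsallis_min t L).choose, (exists_tsallis_min t L).choose_spec.1⟩

/-- The cumulative importance-weighted loss estimates of a player after `t` rounds, from the arms
that the player drew and the losses that the player suffered. -/
def tsallisLoss {K : ℕ} [NeZero K] : (t : ℕ) → (Fin t → Fin K × ℝ) → Fin K → ℝ
  | 0, _ => fun _ => 0
  | t + 1, h => fun k =>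
      tsallisLoss t (Fin.init h) k
        + if (h (Fin.last t)).1 = k then
            (h (Fin.last t)).2 / (tsallisDist t (tsallisLoss t (Fin.init h))).1 k
          else 0

/-- Versatile-DB. The first player is charged loss `1` when `y` wins, the second player is charged
loss `1` when `x` wins. -/
def versatileDB (K : ℕ) [NeZero K] : DuelingAlgorithm K where
  first t h := tsallisDist t
    (tsallisLoss t fun s => ((h s).1, if (h s).2.2 = true then (0 : ℝ) else 1))
  second t h := tsallisDist t
    (tsallisLoss t fun s => ((h s).2.1, if (h s).2.2 = true then (1 : ℝ) else 0))

/-! ### The reduction -/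

/-- One round of MetaDueling: the arms `x` and `y`, the coin `B` and the winning index `I`. -/
abbrev Round (K m : ℕ) : Type := Fin K × Fin K × Bool × Fin m

/-- The number of slots that are filled with `x`. -/
def slotsX (m : ℕ) (B : Bool) : ℕ :=
  if Even m then m / 2 else if B = true then (m + 1) / 2 else m / 2

/-- The multiset: the first `slotsX m B` slots hold `x`, the others hold `y`. -/
def metaMultiset {K : ℕ} (m : ℕ) (x y : Fin K) (B : Bool) (j : Fin m) : Fin K :=
  if j.val < slotsX m B then x else y

/-- What the base algorithm is told about a round: the outcome is `true` when the winning index is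
one of the slots filled for `x`; a round with `x = y` still compares the two groups of slots. -/
def toDuelRecord {K m : ℕ} (r : Round K m) : DuelRecord K :=
  (r.1, r.2.1, decide (r.2.2.2.val < slotsX m r.2.2.1))

/-- The distribution of the first arm in the round that follows the history `h`. -/
def metaFirst {K m : ℕ} (D : DuelingAlgorithm K) (t : ℕ) (h : Fin t → Round K m) :
    stdSimplex ℝ (Fin K) :=
  D.first t fun s => toDuelRecord (h s)

/-- The distribution of the second arm in the round that follows the history `h`. -/
def metaSecond {K m : ℕ} (D : DuelingAlgorithm K) (t : ℕ) (h : Fin t → Round K m) :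
    stdSimplex ℝ (Fin K) :=
  D.second t fun s => toDuelRecord (h s)

/-- The law of the round that follows the history `h`, under the preference matrix `P`. -/
def roundLaw {K m : ℕ} (hm : 2 ≤ m) (D : DuelingAlgorithm K) (P : PreferenceMatrix K) (t : ℕ)
    (h : Fin t → Round K m) : PMF (Round K m) :=
  (armLaw (metaFirst D t h)).bind fun x =>
    (armLaw (metaSecond D t h)).bind fun y =>
      (PMF.uniformOfFintype Bool).bind fun B =>
        (winnerLaw hm P (metaMultiset m x y B)).map fun I => (x, y, B, I)

/-- The law of the first `t` rounds of MetaDueling with base algorithm `D` against the oblivious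
sequence `P`; the rounds are numbered from `0`. -/
def metaLaw {K m : ℕ} (hm : 2 ≤ m) (D : DuelingAlgorithm K) (P : ℕ → PreferenceMatrix K) :
    (t : ℕ) → PMF (Fin t → Round K m)
  | 0 => PMF.pure Fin.elim0
  | t + 1 => (metaLaw hm D P t).bind fun h =>
      (roundLaw hm D (P t) t h).map fun r => Fin.snoc (α := fun _ => Round K m) h r

/-! ### Gaps, rescaling and regret -/

/-- `a` is a Condorcet winner of `P`. -/
def IsCondorcetWinner {K : ℕ} (P : PreferenceMatrix K) (a : Fin K) : Prop :=
  ∀ i, 1 / 2 ≤ P.pref a i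

/-- The rescaling constant `β_m`. -/
def beta (m : ℕ) : ℝ :=
  if Even m then (m : ℝ) / (2 * ((m : ℝ) - 1)) else ((m : ℝ) + 1) / (2 * m)

/-- The rescaling constant `α_m`. -/
def alpha (m : ℕ) : ℝ := (1 - beta m) / 2

/-- The rescaled preferences. -/
def rescaledPref {K : ℕ} (m : ℕ) (P : PreferenceMatrix K) (i j : Fin K) : ℝ :=
  alpha m + beta m * P.pref i j

/-- The gap of arm `i` with respect to `a`. -/
def gap {K : ℕ} (P : PreferenceMatrix K) (a i : Fin K) : ℝ := P.pref a i - 1 / 2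

/-- The gap of arm `i` with respect to `a` under the rescaled preferences. -/
def rescaledGap {K : ℕ} (m : ℕ) (P : PreferenceMatrix K) (a i : Fin K) : ℝ :=
  rescaledPref m P a i - 1 / 2

/-- The cumulative Condorcet pseudo-regret of a run of `T` rounds. -/
def condorcetRegret {K m T : ℕ} (P : ℕ → PreferenceMatrix K) (a : Fin K)
    (h : Fin T → Round K m) : ℝ :=
  ∑ t : Fin T, 1 / (m : ℝ) *
    ∑ j : Fin m, gap (P t) a (metaMultiset m (h t).1 (h t).2.1 (h t).2.2.1 j)

/-- The pseudo-regret of the base algorithm under the rescaled preferences. -/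
def rescaledDuelingRegret {K m T : ℕ} (P : ℕ → PreferenceMatrix K) (a : Fin K)
    (h : Fin T → Round K m) : ℝ :=
  ∑ t : Fin T, 1 / 2 * (rescaledGap m (P t) a (h t).1 + rescaledGap m (P t) a (h t).2.1)

/-- The sum over the rounds and the arms other than `a` of the probabilities with which the two
players draw the arm, weighted by `G`. -/
def weightedSuboptimalMass {K m T : ℕ} (D : DuelingAlgorithm K) (G : Fin K → ℝ) (a : Fin K)
    (h : Fin T → Round K m) : ℝ :=
  ∑ t : Fin T, ∑ i ∈ Finset.univ.erase a,
    ((metaFirst D t (Fin.take t t.isLt.le h)).1 i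
      + (metaSecond D t (Fin.take t t.isLt.le h)).1 i) * G i

/-- The self-bounding condition with gap vector `Δ`, which rescales to `β_m * Δ`. -/
def SelfBounding {K m : ℕ} (hm : 2 ≤ m) (D : DuelingAlgorithm K) (P : ℕ → PreferenceMatrix K)
    (a : Fin K) (Δ : Fin K → ℝ) (T : ℕ) : Prop :=
  1 / 2 * expectation (metaLaw hm D P T)
      (weightedSuboptimalMass D (fun i => beta m * Δ i) a)
    ≤ expectation (metaLaw hm D P T) (rescaledDuelingRegret P a)

end

end MultiDueling

/-!
The expected regret splits between the two players of Versatile-DB. Averaged over the coin, the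
winning group of slots is that of `x` with the rescaled probability `alpha m + beta m * P x y`
(`expectation_roundLaw_duel`), so the base algorithm faces a duel under the rescaled preferences,
and `beta m` times the Condorcet regret of the tuple is the rescaled regret of the pair
(`beta_mul_expectation_condorcetRegret`). Since preferences are reciprocal, the regrets of the two
players against the fixed arm `a`, each in its own bandit problem with losses in `[0, 1]`, add up to
twice the rescaled regret (`expectation_excessLoss`).

Each player runs follow-the-regularized-leader with the regularizer `-2 √t ∑ √p`. First-order
optimality of the leader (`tsallisObjective_add_bregman_le`) gives, along every run, a regret of at
most the stability terms plus the growth of the regularizer (`player_regret_le`). The stability term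
of a round is a maximum over coordinates, found by completing the square in the square roots of the
probabilities. Using it directly, each round costs a player at most `4 √K (√t - √(t - 1))`, which
telescopes to the worst-case bound.

For the logarithmic bound the contribution of `a` itself has to go. Where `a` is drawn and has most
of the mass, the loss is first subtracted from all the loss estimates, after which the stability
term vanishes as the mass of `a` tends to one (`shiftedStabilityBound`). Each round then costs at
most `A / √t * ∑ i ≠ a, √(p i)`, with `A ≤ 4` from the second round on. Subtracting the
self-bounding inequality from the bound on twice the regret leaves
`A / √t * √(p i) - p i * d i / 2 ≤ A ^ 2 / (2 * t * d i)` for each arm, round and player, with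
`d i = beta m * Δ i`, and the harmonic sum over the later rounds is at most `log T`; the first
round goes into the constant. Rounds are counted from `1` here, so `t` stands for `t + 1` in the
lemmas.
-/

namespace MultiDueling

/-! ### Expectations under laws on finite types -/

theorem expectation_bind {α β : Type*} [Fintype α] [Fintype β] (μ : PMF α) (κ : α → PMF β)
    (f : β → ℝ) :
    expectation (μ.bind κ) f = expectation μ fun a => expectation (κ a) f := by
  have hb : ∀ b, (μ.bind κ b).toReal = ∑ a, (μ a).toReal * (κ a b).toReal := by
    intro b
    rw [PMF.bind_apply, tsum_fintype,
      ENNReal.toReal_sum fun a _ => ENNReal.mul_ne_top (μ.apply_ne_top a) ((κ a).apply_ne_top b)]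
    simp
  simp only [expectation, hb, Finset.sum_mul, Finset.mul_sum]
  rw [Finset.sum_comm]
  simp only [mul_assoc]

theorem expectation_pure {α : Type*} [Fintype α] (a : α) (f : α → ℝ) :
    expectation (PMF.pure a) f = f a := by
  classical
  rw [expectation, Finset.sum_eq_single a]
  · simp
  · intro b _ hb
    simp [PMF.pure_apply, hb]
  · simp

theorem expectation_map {α β : Type*} [Fintype α] [Fintype β] (μ : PMF α) (g : α → β)
    (f : β → ℝ) : expectation (μ.map g) f = expectation μ (f ∘ g) := by
  rw [PMF.map, expectation_bind]
  simp only [Function.comp_apply, expectation_pure, Function.comp_def]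

theorem sum_toReal_eq_one {α : Type*} [Fintype α] (μ : PMF α) : ∑ a, (μ a).toReal = 1 := by
  rw [← ENNReal.toReal_sum fun a _ => μ.apply_ne_top a, ← tsum_fintype (L := .unconditional _),
    μ.tsum_coe]
  simp

theorem expectation_const {α : Type*} [Fintype α] (μ : PMF α) (c : ℝ) :
    expectation μ (fun _ => c) = c := by
  rw [expectation, ← Finset.sum_mul, sum_toReal_eq_one, one_mul]

theorem expectation_mono {α : Type*} [Fintype α] (μ : PMF α) {f g : α → ℝ} (h : ∀ a, f a ≤ g a) :
    expectation μ f ≤ expectation μ g :=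
  Finset.sum_le_sum fun a _ => mul_le_mul_of_nonneg_left (h a) ENNReal.toReal_nonneg

theorem expectation_add {α : Type*} [Fintype α] (μ : PMF α) (f g : α → ℝ) :
    expectation μ (fun a => f a + g a) = expectation μ f + expectation μ g := by
  simp only [expectation, mul_add, Finset.sum_add_distrib]

theorem expectation_sub {α : Type*} [Fintype α] (μ : PMF α) (f g : α → ℝ) :
    expectation μ (fun a => f a - g a) = expectation μ f - expectation μ g := by
  simp only [expectation, mul_sub, Finset.sum_sub_distrib]

theorem expectation_const_mul {α : Type*} [Fintype α] (μ : PMF α) (c : ℝ) (f : α → ℝ) :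
    expectation μ (fun a => c * f a) = c * expectation μ f := by
  simp only [expectation, Finset.mul_sum, mul_left_comm]

theorem expectation_armLaw {K : ℕ} (q : stdSimplex ℝ (Fin K)) (f : Fin K → ℝ) :
    expectation (armLaw q) f = ∑ k, q.1 k * f k := by
  refine Finset.sum_congr rfl fun k _ => ?_
  rw [armLaw, PMF.ofFintype_apply, ENNReal.toReal_ofReal (q.2.1 k)]

theorem expectation_winnerLaw {K m : ℕ} (hm : 2 ≤ m) (P : PreferenceMatrix K) (A : Fin m → Fin K)
    (f : Fin m → ℝ) : expectation (winnerLaw hm P A) f = ∑ i, winProb P A i * f i := by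
  refine Finset.sum_congr rfl fun i _ => ?_
  rw [winnerLaw, PMF.ofFintype_apply, ENNReal.toReal_ofReal (winProb_nonneg hm P A i)]

theorem expectation_fairCoin (f : Bool → ℝ) :
    expectation (PMF.uniformOfFintype Bool) f = 1 / 2 * (f true + f false) := by
  simp [expectation]
  ring

/-- The tower property for a sum over the rounds of terms that depend on the past of the round and
on the round itself. -/
theorem expectation_metaLaw_sum {K m : ℕ} (hm : 2 ≤ m) (D : DuelingAlgorithm K)
    (P : ℕ → PreferenceMatrix K) (g : (s : ℕ) → (Fin s → Round K m) → Round K m → ℝ) (T : ℕ) :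
    expectation (metaLaw hm D P T)
        (fun h => ∑ s : Fin T, g s (Fin.take s s.isLt.le h) (h s))
      = ∑ s : Fin T, expectation (metaLaw hm D P s)
          fun h => expectation (roundLaw hm D (P s) s h) (g s h) := by
  induction T with
  | zero => simp [expectation]
  | succ T ih =>
    rw [metaLaw, expectation_bind, Fin.sum_univ_castSucc]
    simp only [expectation_map]
    have hsplit : ∀ (h : Fin T → Round K m) (r : Round K m),
        ∑ s : Fin (T + 1), g s (Fin.take s s.isLt.le
            (Fin.snoc (α := fun _ => Round K m) h r))
            ((Fin.snoc (α := fun _ => Round K m) h r : Fin (T + 1) → Round K m) s)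
          = ∑ s : Fin T, g s (Fin.take s s.isLt.le h) (h s) + g T h r := by
      intro h r
      rw [Fin.sum_univ_castSucc]
      congr 1
      · refine Finset.sum_congr rfl fun s _ => ?_
        rw [Fin.snoc_castSucc]
        congr 1
        funext i
        exact Fin.snoc_castSucc (α := fun _ => Round K m) r h (Fin.castLE s.isLt.le i)
      · rw [Fin.snoc_last]
        congr 1
        funext i
        exact Fin.snoc_castSucc (α := fun _ => Round K m) r h i
    simp only [Function.comp_def, hsplit, expectation_add, expectation_const, ih]
    rfl

/-! ### The regularized leader: positivity and optimality -/

theorem tsallisObjective_eq {K : ℕ} (t : ℕ) (L w : Fin K → ℝ) :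
    tsallisObjective t L w
      = ∑ k, w k * L k - 2 * √((t : ℝ) + 1) * ∑ k, √(w k) := by
  have h : (0 : ℝ) < √((t : ℝ) + 1) := Real.sqrt_pos.2 (by positivity)
  rw [tsallisObjective]
  congr 2
  field_simp
  norm_num

theorem tsallisObjective_tsallisDist_le {K : ℕ} [NeZero K] (t : ℕ) (L : Fin K → ℝ)
    {w : Fin K → ℝ} (hw : w ∈ stdSimplex ℝ (Fin K)) :
    tsallisObjective t L (tsallisDist t L).1 ≤ tsallisObjective t L w :=
  (exists_tsallis_min t L).choose_spec.2 hw

/-- The regularizer has infinite slope at the boundary of the simplex: moving mass `s ^ 2` to an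
arm of probability zero gains order `s` and costs order `s ^ 2`. -/
theorem tsallisDist_pos {K : ℕ} [NeZero K] (t : ℕ) (L : Fin K → ℝ) (k : Fin K) :
    0 < (tsallisDist t L).1 k := by
  set p := (tsallisDist t L).1 with hp
  have hps : p ∈ stdSimplex ℝ (Fin K) := (tsallisDist t L).2
  by_contra hk
  have hk0 : p k = 0 := le_antisymm (not_lt.1 hk) (hps.1 k)
  set c := 2 * √((t : ℝ) + 1) with hc
  have hcpos : 0 < c := by positivity
  have key : ∀ s : ℝ, 0 < s → s ≤ 1 → c ≤ s * (L k - tsallisObjective t L p) := by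
    intro s hs hs1
    have hε0 : 0 < s ^ 2 := by positivity
    have hε1 : s ^ 2 ≤ 1 := by nlinarith
    set w : Fin K → ℝ := fun j => (1 - s ^ 2) * p j + s ^ 2 * (Pi.single k (1 : ℝ) : Fin K → ℝ) j
      with hw
    have hws : w ∈ stdSimplex ℝ (Fin K) :=
      convex_stdSimplex ℝ (Fin K) hps (single_mem_stdSimplex ℝ k) (by linarith) hε0.le (by ring)
    have hmin := tsallisObjective_tsallisDist_le t L hws
    rw [← hp] at hmin
    have hlin : ∑ j, w j * L j = (1 - s ^ 2) * ∑ j, p j * L j + s ^ 2 * L k := by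
      simp only [hw, add_mul, Finset.sum_add_distrib, Finset.mul_sum, mul_assoc]
      congr 1
      simp [Pi.single_apply]
    have hsqrt : (1 - s ^ 2) * ∑ j, √(p j) + s ≤ ∑ j, √(w j) := by
      have : ∀ j, (1 - s ^ 2) * √(p j) + s * (Pi.single k (1 : ℝ) : Fin K → ℝ) j ≤ √(w j) := by
        intro j
        by_cases hj : j = k
        · subst hj
          simp [hw, hk0, Real.sqrt_sq hs.le]
        · simp only [hw, Pi.single_apply, hj, if_false, mul_zero, add_zero]
          refine Real.le_sqrt_of_sq_le ?_
          rw [mul_pow, Real.sq_sqrt (hps.1 j)]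
          exact mul_le_mul_of_nonneg_right (by nlinarith) (hps.1 j)
      calc _ = ∑ j, ((1 - s ^ 2) * √(p j) + s * (Pi.single k (1 : ℝ) : Fin K → ℝ) j) := by
            simp [Finset.sum_add_distrib, Finset.mul_sum, Pi.single_apply]
        _ ≤ _ := Finset.sum_le_sum fun j _ => this j
    rw [tsallisObjective_eq t L w, hlin, ← hc] at hmin
    have h3 : c * ((1 - s ^ 2) * ∑ j, √(p j) + s) ≤ c * ∑ j, √(w j) :=
      mul_le_mul_of_nonneg_left hsqrt hcpos.le
    have h4 : tsallisObjective t L p = ∑ j, p j * L j - c * ∑ j, √(p j) :=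
      tsallisObjective_eq t L p
    have h5 : s * c ≤ s * (s * (L k - tsallisObjective t L p)) := by
      nlinarith
    exact le_of_mul_le_mul_left h5 hs
  set d := L k - tsallisObjective t L p
  have hd : 0 < d := by
    have := key 1 one_pos le_rfl
    linarith
  have h1 := key (min 1 (c / (2 * d))) (lt_min one_pos (by positivity)) (min_le_left _ _)
  have h2 : min 1 (c / (2 * d)) * d ≤ c / (2 * d) * d :=
    mul_le_mul_of_nonneg_right (min_le_right _ _) hd.le
  have h3 : c / (2 * d) * d = c / 2 := by field_simp
  linarith

/-- First-order optimality of the leader: at every other point of the simplex the objective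
exceeds its minimum by at least the Bregman divergence of the regularizer. -/
theorem tsallisObjective_add_bregman_le {K : ℕ} [NeZero K] (t : ℕ) (L : Fin K → ℝ)
    {q : Fin K → ℝ} (hq : q ∈ stdSimplex ℝ (Fin K)) :
    tsallisObjective t L (tsallisDist t L).1
        + √((t : ℝ) + 1) * ∑ k, (√(q k) - √((tsallisDist t L).1 k)) ^ 2 / √((tsallisDist t L).1 k)
      ≤ tsallisObjective t L q := by
  have hpos := tsallisDist_pos t L
  have hps : (tsallisDist t L).1 ∈ stdSimplex ℝ (Fin K) := (tsallisDist t L).2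
  have hmin := fun w hw => tsallisObjective_tsallisDist_le t L (w := w) hw
  generalize (tsallisDist t L).1 = p at *
  set c := 2 * √((t : ℝ) + 1) with hc
  have hcpos : 0 < c := by positivity
  -- Compare the minimizer with the points of the segment towards `q`, divide by the step `ε`.
  have hseg : ∀ ε : ℝ, 0 < ε → ε < 1 →
      c * ∑ k, (q k - p k) / (√(p k + ε * (q k - p k)) + √(p k)) ≤ ∑ k, (q k - p k) * L k := by
    intro ε hε hε1
    have hws : (fun k => p k + ε * (q k - p k)) ∈ stdSimplex ℝ (Fin K) := by
      have := convex_stdSimplex ℝ (Fin K) hps hq (a := 1 - ε) (b := ε) (by linarith) hε.le (by ring)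
      convert this using 1
      funext k
      simp only [Pi.add_apply, Pi.smul_apply, smul_eq_mul]
      ring
    have h := hmin _ hws
    rw [tsallisObjective_eq, tsallisObjective_eq, ← hc] at h
    have hdiff : ∀ k, √(p k + ε * (q k - p k)) - √(p k)
        = ε * ((q k - p k) / (√(p k + ε * (q k - p k)) + √(p k))) := by
      intro k
      have hk : 0 < √(p k) := Real.sqrt_pos.2 (hpos k)
      have hk' : 0 ≤ √(p k + ε * (q k - p k)) := Real.sqrt_nonneg _
      rw [← mul_div_assoc, eq_div_iff (by positivity)]
      have e1 := Real.sq_sqrt (hws.1 k)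
      have e2 := Real.sq_sqrt (hps.1 k)
      simp only at e1
      linear_combination e1 - e2
    have hsum : ∑ k, √(p k + ε * (q k - p k)) - ∑ k, √(p k)
        = ε * ∑ k, (q k - p k) / (√(p k + ε * (q k - p k)) + √(p k)) := by
      rw [← Finset.sum_sub_distrib, Finset.mul_sum]
      exact Finset.sum_congr rfl fun k _ => hdiff k
    have hlin : ∑ k, (p k + ε * (q k - p k)) * L k
        = ∑ k, p k * L k + ε * ∑ k, (q k - p k) * L k := by
      rw [Finset.mul_sum, ← Finset.sum_add_distrib]
      exact Finset.sum_congr rfl fun k _ => by ring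
    rw [hlin] at h
    have h2 : ε * (c * ∑ k, (q k - p k) / (√(p k + ε * (q k - p k)) + √(p k)))
        ≤ ε * ∑ k, (q k - p k) * L k := by
      have : ε * (c * ∑ k, (q k - p k) / (√(p k + ε * (q k - p k)) + √(p k)))
          = c * (∑ k, √(p k + ε * (q k - p k)) - ∑ k, √(p k)) := by rw [hsum]; ring
      rw [this]
      linarith
    exact le_of_mul_le_mul_left h2 hε
  have hlim : Filter.Tendsto
      (fun ε : ℝ => c * ∑ k, (q k - p k) / (√(p k + ε * (q k - p k)) + √(p k)))
      (nhdsWithin 0 (Set.Ioi 0)) (nhds (c * ∑ k, (q k - p k) / (√(p k) + √(p k)))) := by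
    have hcont : ContinuousAt
        (fun ε : ℝ => c * ∑ k, (q k - p k) / (√(p k + ε * (q k - p k)) + √(p k))) 0 := by
      refine ContinuousAt.mul continuousAt_const (tendsto_finsetSum _ fun k _ => ?_)
      have hk : 0 < √(p k) := Real.sqrt_pos.2 (hpos k)
      refine ContinuousAt.div continuousAt_const (by fun_prop) ?_
      have hk' : 0 ≤ √(p k + 0 * (q k - p k)) := Real.sqrt_nonneg _
      positivity
    have := hcont.tendsto.mono_left (nhdsWithin_le_nhds (s := Set.Ioi 0))
    simpa using this
  have hfoc : c * ∑ k, (q k - p k) / (√(p k) + √(p k)) ≤ ∑ k, (q k - p k) * L k := by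
    refine le_of_tendsto hlim ?_
    filter_upwards [Ioo_mem_nhdsGT (zero_lt_one' ℝ)] with ε hε
    exact hseg ε hε.1 hε.2
  rw [tsallisObjective_eq, tsallisObjective_eq, ← hc]
  have hbreg : √((t : ℝ) + 1) * ∑ k, (√(q k) - √(p k)) ^ 2 / √(p k)
      = c * ∑ k, (q k - p k) / (√(p k) + √(p k)) - c * (∑ k, √(q k) - ∑ k, √(p k)) := by
    rw [← Finset.sum_sub_distrib, ← mul_sub, ← Finset.sum_sub_distrib, hc, Finset.mul_sum,
      Finset.mul_sum]
    refine Finset.sum_congr rfl fun k _ => ?_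
    have hk : 0 < √(p k) := Real.sqrt_pos.2 (hpos k)
    have e1 := Real.sq_sqrt (hq.1 k)
    have e2 := Real.sq_sqrt (hps.1 k)
    have : q k - p k = √(q k) ^ 2 - √(p k) ^ 2 := by rw [e1, e2]
    rw [this]
    field_simp
    ring
  have hl : ∑ k, (q k - p k) * L k = ∑ k, q k * L k - ∑ k, p k * L k := by
    rw [← Finset.sum_sub_distrib]
    exact Finset.sum_congr rfl fun k _ => by ring
  linarith

/-! ### Regret of one player along a run -/

/-- The importance-weighted estimate of the loss of arm `j`, from the drawn arm and the suffered
loss in `r`, under the sampling distribution `p`. -/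
noncomputable def lossEstimate {K : ℕ} (p : Fin K → ℝ) (r : Fin K × ℝ) (j : Fin K) : ℝ :=
  if r.1 = j then r.2 / p j else 0

/-- The distribution that a player uses after `t` rounds with the records `h`. -/
noncomputable def playerDist {K : ℕ} [NeZero K] (t : ℕ) (h : Fin t → Fin K × ℝ) : Fin K → ℝ :=
  (tsallisDist t (tsallisLoss t h)).1

theorem playerDist_mem {K : ℕ} [NeZero K] (t : ℕ) (h : Fin t → Fin K × ℝ) :
    playerDist t h ∈ stdSimplex ℝ (Fin K) := (tsallisDist t _).2

theorem playerDist_pos {K : ℕ} [NeZero K] (t : ℕ) (h : Fin t → Fin K × ℝ) (k : Fin K) :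
    0 < playerDist t h k := tsallisDist_pos t _ k

/-- `S` bounds the stability term of the round after `t` rounds: when arm `k` is drawn from `p` and
the loss is in the unit interval, what the estimated loss gains by moving from `p` to another
point `q`, less the Bregman divergence of `q` from `p`, is at most `S t p k`. -/
def IsStabilityBound {K : ℕ} (S : ℕ → (Fin K → ℝ) → Fin K → ℝ) : Prop :=
  ∀ (t : ℕ) (p q : Fin K → ℝ) (k : Fin K) (x : ℝ), p ∈ stdSimplex ℝ (Fin K) → (∀ j, 0 < p j) →
    q ∈ stdSimplex ℝ (Fin K) → 0 ≤ x → x ≤ 1 →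
    ∑ j, (p j - q j) * lossEstimate p (k, x) j
        - √((t : ℝ) + 1) * ∑ j, (√(q j) - √(p j)) ^ 2 / √(p j) ≤ S t p k

theorem tsallisLoss_succ {K : ℕ} [NeZero K] (t : ℕ) (h : Fin (t + 1) → Fin K × ℝ) :
    tsallisLoss (t + 1) h = fun k => tsallisLoss t (Fin.init h) k
      + lossEstimate (playerDist t (Fin.init h)) (h (Fin.last t)) k := rfl

theorem tsallisLoss_eq_sum {K : ℕ} [NeZero K] (T : ℕ) (h : Fin T → Fin K × ℝ) (a : Fin K) :
    tsallisLoss T h a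
      = ∑ s : Fin T, lossEstimate (playerDist s (Fin.take s s.isLt.le h)) (h s) a := by
  induction T with
  | zero => rfl
  | succ T ih =>
    simp only [tsallisLoss_succ, Fin.sum_univ_castSucc, ih]
    rfl

theorem sum_mul_lossEstimate {K : ℕ} {p : Fin K → ℝ} (hp : ∀ j, 0 < p j) (r : Fin K × ℝ) :
    ∑ j, p j * lossEstimate p r j = r.2 := by
  simp only [lossEstimate, mul_ite, mul_zero, Finset.sum_ite_eq, Finset.mem_univ, if_true]
  exact mul_div_cancel₀ _ (hp r.1).ne'

/-- Follow-the-regularized-leader against an arbitrary comparator `u`. The comparator is kept free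
because the induction step uses the hypothesis at the leader of the next round. -/
theorem sum_loss_le_comparator {K : ℕ} [NeZero K] {S : ℕ → (Fin K → ℝ) → Fin K → ℝ}
    (hS : IsStabilityBound S) (T : ℕ) (h : Fin T → Fin K × ℝ)
    (hx : ∀ s, 0 ≤ (h s).2 ∧ (h s).2 ≤ 1) {u : Fin K → ℝ} (hu : u ∈ stdSimplex ℝ (Fin K)) :
    ∑ s, (h s).2 ≤ ∑ k, u k * tsallisLoss T h k - 2 * √(T : ℝ) * ∑ k, √(u k)
      + ∑ s : Fin T, (S s (playerDist s (Fin.take s s.isLt.le h)) (h s).1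
          + 2 * (√((s : ℝ) + 1) - √(s : ℝ))
            * ∑ k, √(playerDist s (Fin.take s s.isLt.le h) k)) := by
  induction T generalizing u with
  | zero => simp [tsallisLoss]
  | succ T ih =>
    set h' : Fin T → Fin K × ℝ := Fin.init h with hh'
    set r := h (Fin.last T) with hr
    set p := playerDist T h' with hp
    have ih' := ih h' (fun s => hx s.castSucc) (playerDist_mem T h')
    rw [← hp] at ih'
    have hstep := tsallisObjective_add_bregman_le T (tsallisLoss T h') hu
    change tsallisObjective T (tsallisLoss T h') p + √((T : ℝ) + 1)
      * ∑ k, (√(u k) - √(p k)) ^ 2 / √(p k) ≤ _ at hstep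
    rw [tsallisObjective_eq, tsallisObjective_eq] at hstep
    have hstab := hS T p u r.1 r.2 (playerDist_mem T h') (playerDist_pos T h') hu
      (hx (Fin.last T)).1 (hx (Fin.last T)).2
    have hest : ∑ j, (p j - u j) * lossEstimate p (r.1, r.2) j
        = r.2 - ∑ j, u j * lossEstimate p r j := by
      simp only [sub_mul, Finset.sum_sub_distrib]
      rw [sum_mul_lossEstimate (playerDist_pos T h')]
    rw [hest] at hstab
    have hL : ∑ k, u k * tsallisLoss (T + 1) h k
        = ∑ k, u k * tsallisLoss T h' k + ∑ k, u k * lossEstimate p r k := by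
      rw [tsallisLoss_succ, ← Finset.sum_add_distrib]
      exact Finset.sum_congr rfl fun k _ => by rw [mul_add]
    rw [Fin.sum_univ_castSucc, Fin.sum_univ_castSucc, hL]
    have e1 : ∑ s : Fin T, (h s.castSucc).2 = ∑ s, (h' s).2 := rfl
    have e2 : (∑ s : Fin T, (S s.castSucc
          (playerDist s.castSucc (Fin.take s.castSucc s.castSucc.isLt.le h)) (h s.castSucc).1
          + 2 * (√(((s.castSucc : ℕ) : ℝ) + 1) - √((s.castSucc : ℕ) : ℝ))
            * ∑ k, √(playerDist s.castSucc (Fin.take s.castSucc s.castSucc.isLt.le h) k)))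
        = ∑ s : Fin T, (S s (playerDist s (Fin.take s s.isLt.le h')) (h' s).1
          + 2 * (√((s : ℝ) + 1) - √(s : ℝ))
            * ∑ k, √(playerDist s (Fin.take s s.isLt.le h') k)) := rfl
    have e3 : playerDist (Fin.last T) (Fin.take (Fin.last T) (Fin.last T).isLt.le h) = p := rfl
    rw [e1, e2, e3, Fin.val_last, ← hr]
    push_cast
    linarith

/-- The regret of a player against the fixed arm `a`, measured with the loss estimates, is at most
the stability terms plus the growth of the regularizer. -/
theorem player_regret_le {K : ℕ} [NeZero K] {S : ℕ → (Fin K → ℝ) → Fin K → ℝ}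
    (hS : IsStabilityBound S) (a : Fin K) (T : ℕ) (h : Fin T → Fin K × ℝ)
    (hx : ∀ s, 0 ≤ (h s).2 ∧ (h s).2 ≤ 1) :
    ∑ s : Fin T, ((h s).2 - lossEstimate (playerDist s (Fin.take s s.isLt.le h)) (h s) a)
      ≤ ∑ s : Fin T, (S s (playerDist s (Fin.take s s.isLt.le h)) (h s).1
          + 2 * (√((s : ℝ) + 1) - √(s : ℝ))
            * (∑ k, √(playerDist s (Fin.take s s.isLt.le h) k) - 1)) := by
  have hmain := sum_loss_le_comparator hS T h hx (single_mem_stdSimplex ℝ a)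
  have e1 : ∑ k, (Pi.single a (1 : ℝ) : Fin K → ℝ) k * tsallisLoss T h k = tsallisLoss T h a := by
    simp [Pi.single_apply]
  have e2 : ∑ k, √((Pi.single a (1 : ℝ) : Fin K → ℝ) k) = 1 := by
    rw [Finset.sum_eq_single a] <;> simp +contextual
  have e3 : ∑ s : Fin T, 2 * (√((s : ℝ) + 1) - √(s : ℝ)) = 2 * √(T : ℝ) := by
    rw [← Finset.mul_sum, Fin.sum_univ_eq_sum_range (fun s => √((s : ℝ) + 1) - √(s : ℝ))]
    have := Finset.sum_range_sub (fun s : ℕ => √(s : ℝ)) T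
    push_cast at this
    rw [this]
    simp
  rw [e1, e2, tsallisLoss_eq_sum, Finset.sum_add_distrib] at hmain
  rw [Finset.sum_sub_distrib, Finset.sum_add_distrib]
  simp only [mul_sub, mul_one, Finset.sum_sub_distrib] at e3 hmain ⊢
  linarith

/-! ### Stability bounds -/

/-- The stability term of one coordinate, with `r ^ 2` and `s ^ 2` for the coordinates of the two
points: completing the square in `r - s`. Negative losses `l` are allowed while `0 < ν + r * l`. -/
theorem stability_coordinate_le {r s l ν : ℝ} (hr : 0 < r) (h : 0 < ν + r * l) :
    (r ^ 2 - s ^ 2) * l - ν * ((s - r) ^ 2 / r) ≤ r ^ 3 * l ^ 2 / (ν + r * l) := by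
  have hsq : r ^ 3 * l ^ 2 / (ν + r * l) - ((r ^ 2 - s ^ 2) * l - ν * ((s - r) ^ 2 / r))
      = (r ^ 2 * l - (r - s) * (ν + r * l)) ^ 2 / (r * (ν + r * l)) := by
    field_simp
    ring
  have : 0 ≤ (r ^ 2 * l - (r - s) * (ν + r * l)) ^ 2 / (r * (ν + r * l)) := by positivity
  linarith

theorem stability_coordinate_le_of_nonneg {r s l ν : ℝ} (hr : 0 < r) (hν : 0 < ν) (hl : 0 ≤ l) :
    (r ^ 2 - s ^ 2) * l - ν * ((s - r) ^ 2 / r) ≤ r ^ 3 * l ^ 2 / ν := by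
  have h := mul_nonneg hr.le hl
  refine (stability_coordinate_le hr (by positivity)).trans ?_
  exact div_le_div_of_nonneg_left (by positivity) hν (by linarith)

/-- The stability bound in local norms: `p k ^ (3 / 2)` times the square of the loss estimate, which
is at most `1 / p k`, divided by `√(t + 1)`. -/
noncomputable def stabilityBound {K : ℕ} (t : ℕ) (p : Fin K → ℝ) (k : Fin K) : ℝ :=
  1 / (√((t : ℝ) + 1) * √(p k))

theorem isStabilityBound_stabilityBound {K : ℕ} :
    IsStabilityBound (stabilityBound (K := K)) := by
  intro t p q k x hp hpos hq hx0 hx1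
  have hν : 0 < √((t : ℝ) + 1) := Real.sqrt_pos.2 (by positivity)
  have hr : ∀ j, 0 < √(p j) := fun j => Real.sqrt_pos.2 (hpos j)
  rw [Finset.mul_sum, ← Finset.sum_sub_distrib]
  have hterm : ∀ j, (p j - q j) * lossEstimate p (k, x) j
      - √((t : ℝ) + 1) * ((√(q j) - √(p j)) ^ 2 / √(p j))
      ≤ if k = j then stabilityBound t p k else 0 := by
    intro j
    have hl : 0 ≤ lossEstimate p (k, x) j := by
      unfold lossEstimate
      split_ifs
      · exact div_nonneg hx0 (hp.1 j)
      · exact le_rfl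
    have h := stability_coordinate_le_of_nonneg (s := √(q j)) (hr j) hν hl
    rw [Real.sq_sqrt (hp.1 j), Real.sq_sqrt (hq.1 j)] at h
    refine h.trans ?_
    by_cases hkj : k = j
    · subst hkj
      simp only [lossEstimate, if_true, stabilityBound]
      have e : √(p k) ^ 3 * (x / p k) ^ 2 / √((t : ℝ) + 1)
          = x ^ 2 * (1 / (√((t : ℝ) + 1) * √(p k))) := by
        have hpk : p k = √(p k) ^ 2 := (Real.sq_sqrt (hp.1 k)).symm
        have hk := hr k
        generalize √(p k) = r at hpk hk
        rw [hpk]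
        field_simp
      rw [e]
      exact mul_le_of_le_one_left (by positivity) (by nlinarith)
    · simp [lossEstimate, hkj]
  exact (Finset.sum_le_sum fun j _ => hterm j).trans (by simp)

/-- A stability bound that is small when the drawn arm is `a` and `a` carries most of the mass. It
comes from subtracting the suffered loss from all loss estimates, which does not change the
comparison of two points of the simplex. -/
noncomputable def shiftedStabilityBound {K : ℕ} (a : Fin K) (t : ℕ) (p : Fin K → ℝ) (k : Fin K) :
    ℝ :=
  if k = a ∧ 1 / 2 ≤ p a then
    ((1 - p a) ^ 2 / √(p a) + 7 / 2 * ∑ j ∈ Finset.univ.erase a, p j * √(p j)) / √((t : ℝ) + 1)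
  else stabilityBound t p k

theorem isStabilityBound_shiftedStabilityBound {K : ℕ} (a : Fin K) :
    IsStabilityBound (shiftedStabilityBound a) := by
  intro t p q k x hp hpos hq hx0 hx1
  unfold shiftedStabilityBound
  split_ifs with hcase
  swap
  · exact isStabilityBound_stabilityBound t p q k x hp hpos hq hx0 hx1
  obtain ⟨rfl, hhalf⟩ := hcase
  set ν := √((t : ℝ) + 1) with hνdef
  have hν1 : 1 ≤ ν := Real.one_le_sqrt.2 (by linarith [t.cast_nonneg (α := ℝ)])
  have hν : 0 < ν := by linarith
  have hr : ∀ j, 0 < √(p j) := fun j => Real.sqrt_pos.2 (hpos j)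
  have hx2 : x ^ 2 ≤ 1 := by nlinarith
  have hshift : ∑ j, (p j - q j) * lossEstimate p (k, x) j
      = ∑ j, (p j - q j) * (lossEstimate p (k, x) j - x) := by
    simp only [mul_sub, Finset.sum_sub_distrib, sub_mul, ← Finset.sum_mul, hp.2, hq.2]
    ring
  rw [hshift, Finset.mul_sum, ← Finset.sum_sub_distrib,
    ← Finset.add_sum_erase _ _ (Finset.mem_univ k), add_div, mul_div_assoc, Finset.sum_div,
    Finset.mul_sum]
  have hpa1 : p k ≤ 1 := hp.2 ▸ Finset.single_le_sum (fun j _ => hp.1 j) (Finset.mem_univ k)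
  refine add_le_add ?_ (Finset.sum_le_sum fun j hj => ?_)
  · have hl : 0 ≤ x / p k - x := by
      rw [sub_nonneg, le_div_iff₀ (hpos k)]
      nlinarith
    have h := stability_coordinate_le_of_nonneg (s := √(q k)) (hr k) hν hl
    rw [Real.sq_sqrt (hp.1 k), Real.sq_sqrt (hq.1 k)] at h
    simp only [lossEstimate, if_true]
    refine h.trans (div_le_div_of_nonneg_right ?_ hν.le)
    have e : √(p k) ^ 3 * (x / p k - x) ^ 2 = x ^ 2 * ((1 - p k) ^ 2 / √(p k)) := by
      have hpk : p k = √(p k) ^ 2 := (Real.sq_sqrt (hp.1 k)).symm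
      have hk := hr k
      generalize √(p k) = r at hpk hk
      rw [hpk]
      field_simp
    rw [e]
    exact mul_le_of_le_one_left (by positivity) hx2
  · have hjk : j ≠ k := Finset.ne_of_mem_erase hj
    have hsum : p j + p k ≤ 1 := by
      rw [← hp.2, ← Finset.sum_pair hjk]
      exact Finset.sum_le_sum_of_subset_of_nonneg (Finset.subset_univ _) fun i _ _ => hp.1 i
    -- An arm other than the drawn one has mass at most `1 / 2 < (5 / 7) ^ 2`.
    have hr5 : √(p j) ≤ 5 / 7 := Real.sqrt_le_iff.2 ⟨by norm_num, by norm_num; linarith⟩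
    have hκ : 2 / 7 * ν ≤ ν + √(p j) * (-x) := by nlinarith [hr j]
    have h := stability_coordinate_le (s := √(q j)) (l := -x) (ν := ν) (hr j) (by linarith)
    rw [Real.sq_sqrt (hp.1 j), Real.sq_sqrt (hq.1 j)] at h
    simp only [lossEstimate, hjk.symm, if_false, zero_sub]
    refine h.trans ?_
    have h3 : √(p j) ^ 3 = p j * √(p j) := by
      rw [pow_succ, Real.sq_sqrt (hp.1 j)]
    have hn : 0 ≤ p j * √(p j) := mul_nonneg (hp.1 j) (hr j).le
    calc √(p j) ^ 3 * (-x) ^ 2 / (ν + √(p j) * -x)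
        ≤ (p j * √(p j)) / (2 / 7 * ν) := by
          rw [h3, neg_sq]
          exact div_le_div₀ hn (mul_le_of_le_one_right hn hx2) (by positivity) hκ
      _ = 7 / 2 * (p j * √(p j) / ν) := by field_simp

theorem mul_stabilityBound {K : ℕ} {p : Fin K → ℝ} (t : ℕ) (hpos : ∀ j, 0 < p j) (k : Fin K) :
    p k * stabilityBound t p k = √(p k) / √((t : ℝ) + 1) := by
  have hν : 0 < √((t : ℝ) + 1) := Real.sqrt_pos.2 (by positivity)
  have hk : 0 < √(p k) := Real.sqrt_pos.2 (hpos k)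
  have hpk : p k = √(p k) ^ 2 := (Real.sq_sqrt (hpos k).le).symm
  unfold stabilityBound
  generalize √(p k) = r at *
  rw [hpk]
  field_simp

theorem sum_mul_stabilityBound {K : ℕ} {p : Fin K → ℝ} (t : ℕ) (hpos : ∀ j, 0 < p j) :
    ∑ k, p k * stabilityBound t p k = (∑ k, √(p k)) / √((t : ℝ) + 1) := by
  rw [Finset.sum_div]
  exact Finset.sum_congr rfl fun k _ => mul_stabilityBound t hpos k

theorem le_sqrt_of_mem_stdSimplex {K : ℕ} {p : Fin K → ℝ} (hp : p ∈ stdSimplex ℝ (Fin K))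
    (j : Fin K) : p j ≤ √(p j) := by
  have h1 : p j ≤ 1 := hp.2 ▸ Finset.single_le_sum (fun j _ => hp.1 j) (Finset.mem_univ j)
  exact Real.le_sqrt_of_sq_le (by nlinarith [hp.1 j])

/-- In expectation over the drawn arm, the stability term is controlled by the arms other than
`a` alone. -/
theorem sum_mul_shiftedStabilityBound_le {K : ℕ} {p : Fin K → ℝ} (a : Fin K) (t : ℕ)
    (hp : p ∈ stdSimplex ℝ (Fin K)) (hpos : ∀ j, 0 < p j) :
    ∑ k, p k * shiftedStabilityBound a t p k
      ≤ 5 / 2 * (∑ j ∈ Finset.univ.erase a, √(p j)) / √((t : ℝ) + 1) := by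
  have hν : 0 < √((t : ℝ) + 1) := Real.sqrt_pos.2 (by positivity)
  have hsplit := Finset.add_sum_erase Finset.univ p (Finset.mem_univ a)
  rw [hp.2] at hsplit
  have hmass : 1 - p a ≤ ∑ j ∈ Finset.univ.erase a, √(p j) := by
    rw [← hsplit, add_sub_cancel_left]
    exact Finset.sum_le_sum fun j _ => le_sqrt_of_mem_stdSimplex hp j
  have hrest : ∑ k ∈ Finset.univ.erase a, p k * shiftedStabilityBound a t p k
      = (∑ j ∈ Finset.univ.erase a, √(p j)) / √((t : ℝ) + 1) := by
    rw [Finset.sum_div]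
    refine Finset.sum_congr rfl fun k hk => ?_
    rw [shiftedStabilityBound, if_neg fun h => Finset.ne_of_mem_erase hk h.1,
      mul_stabilityBound t hpos]
  rw [← Finset.add_sum_erase _ _ (Finset.mem_univ a), hrest]
  set B := ∑ j ∈ Finset.univ.erase a, √(p j) with hB
  have hra : 0 < √(p a) := Real.sqrt_pos.2 (hpos a)
  have hra1 : √(p a) ≤ 1 := Real.sqrt_le_one.2 (by
    have := Finset.sum_nonneg fun j (_ : j ∈ Finset.univ.erase a) => hp.1 j
    linarith)
  -- The arms other than `a` contribute `1` to the factor `5 / 2`, which leaves `3 / 2` for `a`.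
  suffices h : p a * shiftedStabilityBound a t p a ≤ 3 / 2 * B / √((t : ℝ) + 1) by
    calc _ ≤ 3 / 2 * B / √((t : ℝ) + 1) + B / √((t : ℝ) + 1) := by linarith
      _ = _ := by ring
  by_cases hhalf : 1 / 2 ≤ p a
  · rw [shiftedStabilityBound, if_pos ⟨rfl, hhalf⟩, ← mul_div_assoc]
    refine div_le_div_of_nonneg_right ?_ hν.le
    have hdiag : p a * ((1 - p a) ^ 2 / √(p a)) = √(p a) * (1 - p a) ^ 2 := by
      rw [mul_div_left_comm, Real.div_sqrt, mul_comm]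
    have hcross : ∑ j ∈ Finset.univ.erase a, p j * √(p j) ≤ (1 - p a) * B := by
      rw [hB, Finset.mul_sum]
      refine Finset.sum_le_sum fun j hj => mul_le_mul_of_nonneg_right ?_ (Real.sqrt_nonneg _)
      have := Finset.single_le_sum (fun i (_ : i ∈ Finset.univ.erase a) => hp.1 i) hj
      linarith
    have hB0 : 0 ≤ B := Finset.sum_nonneg fun j _ => Real.sqrt_nonneg _
    have hε0 : 0 ≤ 1 - p a := by
      have := Finset.sum_nonneg fun j (_ : j ∈ Finset.univ.erase a) => hp.1 j
      linarith
    have h1 : √(p a) * (1 - p a) ^ 2 ≤ 1 / 2 * B := by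
      have : √(p a) * (1 - p a) ^ 2 ≤ 1 * (1 - p a) ^ 2 :=
        mul_le_mul_of_nonneg_right hra1 (by positivity)
      nlinarith
    have h2 : p a * ∑ j ∈ Finset.univ.erase a, p j * √(p j) ≤ 1 / 4 * B := by
      calc _ ≤ p a * ((1 - p a) * B) := mul_le_mul_of_nonneg_left hcross (hp.1 a)
        _ = (p a * (1 - p a)) * B := by ring
        _ ≤ _ := mul_le_mul_of_nonneg_right (by nlinarith [sq_nonneg (p a - 1 / 2)]) hB0
    rw [mul_add, hdiag]
    linarith
  · rw [shiftedStabilityBound, if_neg fun h => hhalf h.2, mul_stabilityBound t hpos]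
    refine div_le_div_of_nonneg_right ?_ hν.le
    have : √(p a) ≤ 3 / 4 := Real.sqrt_le_iff.2 ⟨by norm_num, by norm_num; linarith⟩
    linarith

/-! ### One round of the reduction -/

theorem expectation_roundLaw {K m : ℕ} (hm : 2 ≤ m) (D : DuelingAlgorithm K)
    (P : PreferenceMatrix K) (t : ℕ) (h : Fin t → Round K m) (f : Round K m → ℝ) :
    expectation (roundLaw hm D P t h) f
      = ∑ x, (metaFirst D t h).1 x * ∑ y, (metaSecond D t h).1 y *
          (1 / 2 * (∑ i, winProb P (metaMultiset m x y true) i * f (x, y, true, i)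
            + ∑ i, winProb P (metaMultiset m x y false) i * f (x, y, false, i))) := by
  simp only [roundLaw, expectation_bind, expectation_armLaw, expectation_fairCoin,
    expectation_map, expectation_winnerLaw, Function.comp_apply]

theorem slotsX_le (m : ℕ) (B : Bool) : slotsX m B ≤ m := by
  unfold slotsX
  split_ifs with h1
  · omega
  · rcases Nat.not_even_iff_odd.1 h1 with ⟨k, rfl⟩
    omega
  · omega

theorem card_filter_lt_slotsX (m : ℕ) (B : Bool) :
    (Finset.univ.filter fun i : Fin m => i.val < slotsX m B).card = slotsX m B := by
  rw [Fin.card_filter_val_lt]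
  exact min_eq_right (slotsX_le m B)

/-- A function of the arm in a slot, summed over the slots. -/
theorem sum_metaMultiset {K m : ℕ} (x y : Fin K) (B : Bool) (f : Fin K → ℝ) :
    ∑ j, f (metaMultiset m x y B j) = slotsX m B * f x + (m - slotsX m B : ℝ) * f y := by
  have h : ∀ j : Fin m, f (metaMultiset m x y B j)
      = f y + if j.val < slotsX m B then f x - f y else 0 := by
    intro j
    unfold metaMultiset
    split_ifs <;> ring
  simp only [h, Finset.sum_add_distrib, ← Finset.sum_filter, Finset.sum_const,
    card_filter_lt_slotsX, Finset.card_univ, Fintype.card_fin, nsmul_eq_mul]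
  ring

theorem winProb_eq {K m : ℕ} (P : PreferenceMatrix K) (x y : Fin K) (B : Bool) {i : Fin m}
    (hi : i.val < slotsX m B) :
    winProb P (metaMultiset m x y B) i
      = 2 / ((m : ℝ) * ((m : ℝ) - 1)) *
        ((slotsX m B - 1 : ℝ) / 2 + (m - slotsX m B : ℝ) * P.pref x y) := by
  have hAi : metaMultiset m x y B i = x := by simp [metaMultiset, hi]
  have hfull := sum_metaMultiset (m := m) x y B (P.pref x)
  rw [← Finset.add_sum_erase _ _ (Finset.mem_univ i), hAi, P.self_comparison] at hfull
  have : winProb P (metaMultiset m x y B) i = 2 / ((m : ℝ) * ((m : ℝ) - 1)) *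
      ∑ j ∈ Finset.univ.erase i, P.pref x (metaMultiset m x y B j) := by
    rw [winProb, Finset.mul_sum, hAi]
    exact Finset.sum_congr rfl fun j _ => by ring
  rw [this]
  congr 1
  linarith

/-- The probability that one of the slots of `x` wins, given the coin. -/
theorem sum_winProb_slotsX {K m : ℕ} (P : PreferenceMatrix K) (x y : Fin K) (B : Bool) :
    ∑ i : Fin m with i.val < slotsX m B, winProb P (metaMultiset m x y B) i
      = slotsX m B * (2 / ((m : ℝ) * ((m : ℝ) - 1)) *
        ((slotsX m B - 1 : ℝ) / 2 + (m - slotsX m B : ℝ) * P.pref x y)) := by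
  rw [Finset.sum_congr rfl fun i hi => winProb_eq P x y B (Finset.mem_filter.1 hi).2,
    Finset.sum_const, card_filter_lt_slotsX, nsmul_eq_mul]

/-- Averaged over the coin, the slots of `x` win with the rescaled preference of `x` over `y`. -/
theorem coin_average_sum_winProb {K m : ℕ} (hm : 2 ≤ m) (P : PreferenceMatrix K) (x y : Fin K) :
    1 / 2 * (∑ i : Fin m with i.val < slotsX m true, winProb P (metaMultiset m x y true) i
        + ∑ i : Fin m with i.val < slotsX m false, winProb P (metaMultiset m x y false) i)
      = rescaledPref m P x y := by
  have h2 : (2 : ℝ) ≤ m := by exact_mod_cast hm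
  have hm0 : (m : ℝ) ≠ 0 := by linarith
  have hm1 : (m : ℝ) - 1 ≠ 0 := by linarith
  rw [sum_winProb_slotsX, sum_winProb_slotsX, rescaledPref, alpha, beta]
  rcases Nat.even_or_odd m with he | ho
  · obtain ⟨k, rfl⟩ := he
    have hk : (k + k) / 2 = k := by omega
    simp only [slotsX, Even.add_self, if_true, hk]
    push_cast at hm0 hm1 ⊢
    rw [← two_mul] at hm0 hm1
    rw [show (k : ℝ) + k = 2 * k from (two_mul _).symm]
    have hk0 : (k : ℝ) ≠ 0 := fun h => hm0 (by rw [h]; norm_num)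
    field_simp
    ring
  · have hne := Nat.not_even_iff_odd.2 ho
    obtain ⟨k, rfl⟩ := ho
    have hk : (2 * k + 1) / 2 = k := by omega
    have hk' : (2 * k + 1 + 1) / 2 = k + 1 := by omega
    simp only [slotsX, hne, if_false, if_true, hk, hk', Bool.false_eq_true]
    push_cast at hm0 hm1 ⊢
    have hk0 : (k : ℝ) ≠ 0 := fun h => hm1 (by rw [h]; norm_num)
    field_simp
    ring

theorem slotsX_true_add_false (m : ℕ) : (slotsX m true : ℝ) + slotsX m false = m := by
  have : slotsX m true + slotsX m false = m := by
    rcases Nat.even_or_odd m with he | ho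
    · simp only [slotsX, he, if_true]
      obtain ⟨k, rfl⟩ := he
      omega
    · simp only [slotsX, Nat.not_even_iff_odd.2 ho, if_false, if_true, Bool.false_eq_true]
      obtain ⟨k, rfl⟩ := ho
      omega
  exact_mod_cast this

/-- The law of the two arms and the binary outcome that the base algorithm sees is that of a duel
under the rescaled preferences. -/
theorem expectation_roundLaw_duel {K m : ℕ} (hm : 2 ≤ m) (D : DuelingAlgorithm K)
    (P : PreferenceMatrix K) (t : ℕ) (h : Fin t → Round K m) (F : DuelRecord K → ℝ) :
    expectation (roundLaw hm D P t h) (fun r => F (toDuelRecord r))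
      = ∑ x, (metaFirst D t h).1 x * ∑ y, (metaSecond D t h).1 y *
          (rescaledPref m P x y * F (x, y, true)
            + (1 - rescaledPref m P x y) * F (x, y, false)) := by
  rw [expectation_roundLaw]
  refine Finset.sum_congr rfl fun x _ => congrArg _ (Finset.sum_congr rfl fun y _ => congrArg _ ?_)
  have hB : ∀ B : Bool, ∑ i : Fin m, winProb P (metaMultiset m x y B) i
        * F (toDuelRecord (x, y, B, i))
      = (∑ i : Fin m with i.val < slotsX m B, winProb P (metaMultiset m x y B) i)
          * (F (x, y, true) - F (x, y, false)) + F (x, y, false) := by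
    intro B
    have h1 := sum_winProb hm P (metaMultiset m x y B)
    have : ∀ i : Fin m, winProb P (metaMultiset m x y B) i * F (toDuelRecord (x, y, B, i))
        = (if i.val < slotsX m B then winProb P (metaMultiset m x y B) i else 0)
            * (F (x, y, true) - F (x, y, false))
          + winProb P (metaMultiset m x y B) i * F (x, y, false) := by
      intro i
      unfold toDuelRecord
      by_cases hi : i.val < slotsX m B
      · simp only [hi, decide_true, if_true]
        ring
      · simp [hi]
    rw [Finset.sum_congr rfl fun i _ => this i, Finset.sum_add_distrib, ← Finset.sum_mul,
      ← Finset.sum_mul, h1, Finset.sum_filter, one_mul]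
  rw [hB true, hB false, ← coin_average_sum_winProb hm P x y]
  ring

theorem beta_pos {m : ℕ} (hm : 2 ≤ m) : 0 < beta m := by
  have h2 : (2 : ℝ) ≤ m := by exact_mod_cast hm
  unfold beta
  split_ifs
  · exact div_pos (by linarith) (by linarith)
  · exact div_pos (by linarith) (by linarith)

theorem half_le_beta {m : ℕ} (hm : 2 ≤ m) : 1 / 2 ≤ beta m := by
  have h2 : (2 : ℝ) ≤ m := by exact_mod_cast hm
  unfold beta
  split_ifs
  · rw [div_le_div_iff₀ (by norm_num) (by linarith)]
    linarith
  · rw [div_le_div_iff₀ (by norm_num) (by linarith)]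
    linarith

theorem rescaledGap_eq {K : ℕ} (m : ℕ) (P : PreferenceMatrix K) (a i : Fin K) :
    rescaledGap m P a i = beta m * gap P a i := by
  rw [rescaledGap, rescaledPref, alpha, gap]
  ring

theorem rescaledPref_add_swap {K : ℕ} (m : ℕ) (P : PreferenceMatrix K) (i j : Fin K) :
    rescaledPref m P i j + rescaledPref m P j i = 1 := by
  have := P.reciprocal i j
  rw [rescaledPref, rescaledPref, alpha]
  linear_combination beta m * this

/-- The rescaling turns the Condorcet pseudo-regret into that of the base algorithm. -/
theorem beta_mul_expectation_condorcetRegret {K m : ℕ} (hm : 2 ≤ m) (D : DuelingAlgorithm K)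
    (P : ℕ → PreferenceMatrix K) (a : Fin K) (T : ℕ) :
    beta m * expectation (metaLaw hm D P T) (condorcetRegret P a)
      = expectation (metaLaw hm D P T) (rescaledDuelingRegret P a) := by
  have h1 := expectation_metaLaw_sum hm D P (fun s _ r => 1 / (m : ℝ) *
    ∑ j : Fin m, gap (P s) a (metaMultiset m r.1 r.2.1 r.2.2.1 j)) T
  have h2 := expectation_metaLaw_sum hm D P (fun s _ r =>
    1 / 2 * (rescaledGap m (P s) a r.1 + rescaledGap m (P s) a r.2.1)) T
  unfold condorcetRegret rescaledDuelingRegret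
  rw [h1, h2, Finset.mul_sum]
  refine Finset.sum_congr rfl fun s _ => ?_
  rw [← expectation_const_mul]
  congr 1
  funext h
  have hm0 : (m : ℝ) ≠ 0 := by
    have : (2 : ℝ) ≤ m := by exact_mod_cast hm
    linarith
  rw [expectation_roundLaw, expectation_roundLaw, Finset.mul_sum]
  refine Finset.sum_congr rfl fun x _ => ?_
  rw [mul_left_comm, Finset.mul_sum]
  refine congrArg _ (Finset.sum_congr rfl fun y _ => ?_)
  rw [mul_left_comm]
  refine congrArg _ ?_
  simp only [← Finset.sum_mul, sum_winProb hm, one_mul, sum_metaMultiset, rescaledGap_eq]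
  have h3 := slotsX_true_add_false m
  rw [← eq_sub_iff_add_eq] at h3
  rw [h3]
  field_simp
  ring

/-! ### The two players of Versatile-DB -/

/-- The arm that the first player draws and the loss that it suffers. -/
noncomputable def firstRecord {K m : ℕ} (r : Round K m) : Fin K × ℝ :=
  ((toDuelRecord r).1, if (toDuelRecord r).2.2 = true then 0 else 1)

/-- The arm that the second player draws and the loss that it suffers. -/
noncomputable def secondRecord {K m : ℕ} (r : Round K m) : Fin K × ℝ :=
  ((toDuelRecord r).2.1, if (toDuelRecord r).2.2 = true then 1 else 0)

theorem firstRecord_mem {K m : ℕ} (r : Round K m) :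
    0 ≤ (firstRecord r).2 ∧ (firstRecord r).2 ≤ 1 := by
  unfold firstRecord
  split_ifs <;> simp

theorem secondRecord_mem {K m : ℕ} (r : Round K m) :
    0 ≤ (secondRecord r).2 ∧ (secondRecord r).2 ≤ 1 := by
  unfold secondRecord
  split_ifs <;> simp

theorem metaFirst_versatileDB {K m : ℕ} [NeZero K] (t : ℕ) (h : Fin t → Round K m) :
    (metaFirst (versatileDB K) t h).1 = playerDist t (fun s => firstRecord (h s)) := rfl

theorem metaSecond_versatileDB {K m : ℕ} [NeZero K] (t : ℕ) (h : Fin t → Round K m) :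
    (metaSecond (versatileDB K) t h).1 = playerDist t (fun s => secondRecord (h s)) := rfl

/-- The loss that one player suffers in excess of the estimated loss of arm `a`. -/
noncomputable def excessLoss {K : ℕ} (p : Fin K → ℝ) (a : Fin K) (r : Fin K × ℝ) : ℝ :=
  r.2 - lossEstimate p r a

/-- In expectation, the excess losses of the two players add up to twice the rescaled regret of the
round, since preferences are reciprocal. -/
theorem expectation_excessLoss {K m : ℕ} [NeZero K] (hm : 2 ≤ m)
    (P : PreferenceMatrix K) (a : Fin K) (t : ℕ) (h : Fin t → Round K m) :
    expectation (roundLaw hm (versatileDB K) P t h) (fun r =>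
        excessLoss (metaFirst (versatileDB K) t h).1 a (firstRecord r)
          + excessLoss (metaSecond (versatileDB K) t h).1 a (secondRecord r))
      = 2 * expectation (roundLaw hm (versatileDB K) P t h) (fun r =>
          1 / 2 * (rescaledGap m P a r.1 + rescaledGap m P a r.2.1)) := by
  have hp : ∀ k, 0 < (metaFirst (versatileDB K) t h).1 k := fun k => playerDist_pos _ _ k
  have hq : ∀ k, 0 < (metaSecond (versatileDB K) t h).1 k := fun k => playerDist_pos _ _ k
  have hp1 := (metaFirst (versatileDB K) t h).2.2
  have hq1 := (metaSecond (versatileDB K) t h).2.2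
  have e1 := expectation_roundLaw_duel hm (versatileDB K) P t h (fun d =>
    excessLoss (metaFirst (versatileDB K) t h).1 a (d.1, if d.2.2 = true then 0 else 1)
      + excessLoss (metaSecond (versatileDB K) t h).1 a (d.2.1, if d.2.2 = true then 1 else 0))
  have e2 := expectation_roundLaw_duel hm (versatileDB K) P t h (fun d =>
    1 / 2 * (rescaledGap m P a d.1 + rescaledGap m P a d.2.1))
  refine e1.trans (Eq.trans ?_ (congrArg (2 * ·) e2).symm)
  generalize (metaFirst (versatileDB K) t h).1 = p at *
  generalize (metaSecond (versatileDB K) t h).1 = q at *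
  simp only [excessLoss, lossEstimate, if_true, Bool.false_eq_true, if_false, zero_div, ite_self]
  -- The importance weights cancel the probability of drawing `a`.
  have hx : ∀ x y, p x * (q y * (if x = a then 1 / p a else 0)) = if x = a then q y else 0 := by
    intro x y
    split_ifs with hxa
    · subst hxa
      have := (hp x).ne'
      field_simp
    · simp
  have hy : ∀ x y, p x * (q y * (if y = a then 1 / q a else 0)) = if y = a then p x else 0 := by
    intro x y
    split_ifs with hya
    · subst hya
      have := (hq y).ne'
      field_simp
    · simp
  have hlhs : ∀ x y, p x * (q y * (rescaledPref m P x y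
        * (0 - 0 + (1 - if y = a then 1 / q a else 0))
        + (1 - rescaledPref m P x y) * (1 - (if x = a then 1 / p a else 0) + (0 - 0))))
      = p x * q y - rescaledPref m P x y * (if y = a then p x else 0)
        - (1 - rescaledPref m P x y) * (if x = a then q y else 0) := by
    intro x y
    rw [← hx x y, ← hy x y]
    ring
  have hrhs : ∀ x y, p x * (q y * (rescaledPref m P x y
        * (1 / 2 * (rescaledGap m P a x + rescaledGap m P a y))
        + (1 - rescaledPref m P x y) * (1 / 2 * (rescaledGap m P a x + rescaledGap m P a y))))
      = 1 / 2 * (p x * rescaledGap m P a x * q y + p x * (q y * rescaledGap m P a y)) := by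
    intro x y
    ring
  have hdist : ∀ x (f : Fin K → ℝ), p x * ∑ y, q y * f y = ∑ y, p x * (q y * f y) :=
    fun x f => Finset.mul_sum _ _ _
  simp only [hdist, hlhs, hrhs, Finset.sum_sub_distrib, mul_ite, mul_zero]
  simp only [← Finset.mul_sum, Finset.sum_add_distrib, hq1, mul_one, ← Finset.sum_mul, hp1,
    one_mul, Finset.sum_ite_eq', Finset.mem_univ, if_true]
  rw [Finset.sum_comm (f := fun x y => if x = a then (1 - rescaledPref m P x y) * q y else 0)]
  simp only [Finset.sum_ite_eq', Finset.mem_univ, if_true, rescaledGap]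
  have hswap : ∀ x, rescaledPref m P x a = 1 - rescaledPref m P a x := fun x => by
    linarith [rescaledPref_add_swap m P a x]
  simp only [hswap, sub_mul, mul_sub, Finset.sum_sub_distrib, one_mul, hp1, hq1,
    ← Finset.sum_mul]
  simp only [mul_comm]
  ring

theorem expectation_roundLaw_first {K m : ℕ} (hm : 2 ≤ m) (D : DuelingAlgorithm K)
    (P : PreferenceMatrix K) (t : ℕ) (h : Fin t → Round K m) (f : Fin K → ℝ) :
    expectation (roundLaw hm D P t h) (fun r => f r.1)
      = ∑ x, (metaFirst D t h).1 x * f x := by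
  rw [roundLaw, expectation_bind, expectation_armLaw]
  simp only [expectation_bind, expectation_map, Function.comp_def, expectation_const]

theorem expectation_roundLaw_second {K m : ℕ} (hm : 2 ≤ m) (D : DuelingAlgorithm K)
    (P : PreferenceMatrix K) (t : ℕ) (h : Fin t → Round K m) (f : Fin K → ℝ) :
    expectation (roundLaw hm D P t h) (fun r => f r.2.1)
      = ∑ y, (metaSecond D t h).1 y * f y := by
  rw [roundLaw, expectation_bind]
  simp only [expectation_bind, expectation_map, Function.comp_def, expectation_const]
  rw [expectation_armLaw]

/-- The bound on the expected regret of one player in the round after `t` rounds, given the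
distribution `p` of the player: stability plus growth of the regularizer. -/
noncomputable def playerBound {K : ℕ} (S : ℕ → (Fin K → ℝ) → Fin K → ℝ) (t : ℕ)
    (p : Fin K → ℝ) : ℝ :=
  ∑ k, p k * S t p k + 2 * (√((t : ℝ) + 1) - √(t : ℝ)) * (∑ k, √(p k) - 1)

/-- Regret of Versatile-DB under the rescaled preferences, for an arbitrary stability bound. -/
theorem two_mul_rescaledDuelingRegret_le {K m : ℕ} [NeZero K] (hm : 2 ≤ m)
    (P : ℕ → PreferenceMatrix K) (a : Fin K) (T : ℕ) {S : ℕ → (Fin K → ℝ) → Fin K → ℝ}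
    (hS : IsStabilityBound S) :
    2 * expectation (metaLaw hm (versatileDB K) P T) (rescaledDuelingRegret P a)
      ≤ expectation (metaLaw hm (versatileDB K) P T) (fun h => ∑ s : Fin T,
          (playerBound S s (metaFirst (versatileDB K) s (Fin.take s s.isLt.le h)).1
            + playerBound S s (metaSecond (versatileDB K) s (Fin.take s s.isLt.le h)).1)) := by
  set D := versatileDB K with hD
  have e1 := expectation_metaLaw_sum hm D P (fun s _ r =>
    1 / 2 * (rescaledGap m (P s) a r.1 + rescaledGap m (P s) a r.2.1)) T
  have e2 := expectation_metaLaw_sum hm D P (fun s h r =>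
    excessLoss (metaFirst D s h).1 a (firstRecord r)
      + excessLoss (metaSecond D s h).1 a (secondRecord r)) T
  have e3 := expectation_metaLaw_sum hm D P (fun s h r =>
    (S s (metaFirst D s h).1 r.1
        + 2 * (√((s : ℝ) + 1) - √(s : ℝ)) * (∑ k, √((metaFirst D s h).1 k) - 1))
      + (S s (metaSecond D s h).1 r.2.1
        + 2 * (√((s : ℝ) + 1) - √(s : ℝ)) * (∑ k, √((metaSecond D s h).1 k) - 1))) T
  have e4 := expectation_metaLaw_sum hm D P (fun s h _ =>
    playerBound S s (metaFirst D s h).1 + playerBound S s (metaSecond D s h).1) T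
  unfold rescaledDuelingRegret
  rw [e1, e4, Finset.mul_sum]
  have h12 : ∀ s : Fin T, 2 * expectation (metaLaw hm D P s) (fun h =>
      expectation (roundLaw hm D (P s) s h) fun r =>
        1 / 2 * (rescaledGap m (P s) a r.1 + rescaledGap m (P s) a r.2.1))
      = expectation (metaLaw hm D P s) (fun h => expectation (roundLaw hm D (P s) s h) fun r =>
        excessLoss (metaFirst D s h).1 a (firstRecord r)
          + excessLoss (metaSecond D s h).1 a (secondRecord r)) := by
    intro s
    rw [← expectation_const_mul]
    congr 1
    funext h
    exact (expectation_excessLoss hm (P s) a s h).symm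
  have h34 : ∀ s : Fin T, expectation (metaLaw hm D P s) (fun h =>
      expectation (roundLaw hm D (P s) s h) fun _ =>
        playerBound S s (metaFirst D s h).1 + playerBound S s (metaSecond D s h).1)
      = expectation (metaLaw hm D P s) (fun h => expectation (roundLaw hm D (P s) s h) fun r =>
        (S s (metaFirst D s h).1 r.1
            + 2 * (√((s : ℝ) + 1) - √(s : ℝ)) * (∑ k, √((metaFirst D s h).1 k) - 1))
          + (S s (metaSecond D s h).1 r.2.1
            + 2 * (√((s : ℝ) + 1) - √(s : ℝ)) * (∑ k, √((metaSecond D s h).1 k) - 1))) := by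
    intro s
    congr 1
    funext h
    simp only [expectation_add, expectation_const]
    rw [expectation_roundLaw_first hm D (P s) s h (S s (metaFirst D s h).1),
      expectation_roundLaw_second hm D (P s) s h (S s (metaSecond D s h).1)]
    rfl
  rw [Finset.sum_congr rfl fun s _ => h12 s, Finset.sum_congr rfl fun s _ => h34 s, ← e2, ← e3]
  refine expectation_mono _ fun h => ?_
  rw [Finset.sum_add_distrib, Finset.sum_add_distrib]
  exact add_le_add
    (player_regret_le hS a T (fun s => firstRecord (h s)) fun s => firstRecord_mem _)
    (player_regret_le hS a T (fun s => secondRecord (h s)) fun s => secondRecord_mem _)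

/-! ### The worst-case bound -/

theorem sum_sqrt_le_sqrt_card {K : ℕ} {p : Fin K → ℝ} (hp : p ∈ stdSimplex ℝ (Fin K)) :
    ∑ k, √(p k) ≤ √(K : ℝ) := by
  refine Real.le_sqrt_of_sq_le ?_
  have h := sq_sum_le_card_mul_sum_sq (s := Finset.univ) (f := fun k => √(p k))
  simp only [fun k => Real.sq_sqrt (hp.1 k), hp.2] at h
  simpa using h

theorem one_div_sqrt_succ_le (t : ℕ) :
    1 / √((t : ℝ) + 1) ≤ 2 * (√((t : ℝ) + 1) - √(t : ℝ)) := by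
  have ht : (0 : ℝ) ≤ t := t.cast_nonneg
  have hν : 0 < √((t : ℝ) + 1) := Real.sqrt_pos.2 (by positivity)
  have h1 := Real.sq_sqrt ht
  have h2 := Real.sq_sqrt (show (0 : ℝ) ≤ (t : ℝ) + 1 by positivity)
  rw [div_le_iff₀ hν]
  nlinarith [sq_nonneg (√((t : ℝ) + 1) - √(t : ℝ))]

theorem playerBound_stabilityBound_le {K : ℕ} {p : Fin K → ℝ} (t : ℕ)
    (hp : p ∈ stdSimplex ℝ (Fin K)) (hpos : ∀ j, 0 < p j) :
    playerBound stabilityBound t p ≤ 4 * √(K : ℝ) * (√((t : ℝ) + 1) - √(t : ℝ)) := by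
  have hd : 0 ≤ √((t : ℝ) + 1) - √(t : ℝ) :=
    sub_nonneg.2 (Real.sqrt_le_sqrt (by linarith))
  have hK := sum_sqrt_le_sqrt_card hp
  have h1 := one_div_sqrt_succ_le t
  have h2 : (∑ k, √(p k)) / √((t : ℝ) + 1)
      ≤ √(K : ℝ) * (2 * (√((t : ℝ) + 1) - √(t : ℝ))) := by
    rw [div_eq_mul_one_div]
    exact mul_le_mul hK h1 (by positivity) (Real.sqrt_nonneg _)
  have h3 : 2 * (√((t : ℝ) + 1) - √(t : ℝ)) * (∑ k, √(p k) - 1)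
      ≤ 2 * (√((t : ℝ) + 1) - √(t : ℝ)) * √(K : ℝ) :=
    mul_le_mul_of_nonneg_left (by linarith) (by linarith)
  rw [playerBound, sum_mul_stabilityBound t hpos]
  linarith

theorem rescaledDuelingRegret_le_sqrt {K m : ℕ} [NeZero K] (hm : 2 ≤ m)
    (P : ℕ → PreferenceMatrix K) (a : Fin K) (T : ℕ) :
    expectation (metaLaw hm (versatileDB K) P T) (rescaledDuelingRegret P a)
      ≤ 4 * √((K : ℝ) * T) := by
  have h := two_mul_rescaledDuelingRegret_le hm P a T isStabilityBound_stabilityBound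
  have hsum : ∑ s : Fin T, (√((s : ℝ) + 1) - √(s : ℝ)) = √(T : ℝ) := by
    rw [Fin.sum_univ_eq_sum_range (fun s => √((s : ℝ) + 1) - √(s : ℝ))]
    have := Finset.sum_range_sub (fun s : ℕ => √(s : ℝ)) T
    push_cast at this
    rw [this]
    simp
  have hpath : expectation (metaLaw hm (versatileDB K) P T) (fun h => ∑ s : Fin T,
      (playerBound stabilityBound s (metaFirst (versatileDB K) s (Fin.take s s.isLt.le h)).1
        + playerBound stabilityBound s
            (metaSecond (versatileDB K) s (Fin.take s s.isLt.le h)).1))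
      ≤ expectation (metaLaw hm (versatileDB K) P T) fun _ => 8 * √(K : ℝ) * √(T : ℝ) := by
    refine expectation_mono _ fun h => ?_
    rw [← hsum, Finset.mul_sum]
    refine Finset.sum_le_sum fun s _ => ?_
    have h1 := playerBound_stabilityBound_le s
      (playerDist_mem s fun i => firstRecord (Fin.take s s.isLt.le h i)) (playerDist_pos s _)
    have h2 := playerBound_stabilityBound_le s
      (playerDist_mem s fun i => secondRecord (Fin.take s s.isLt.le h i)) (playerDist_pos s _)
    rw [metaFirst_versatileDB, metaSecond_versatileDB]
    linarith
  rw [expectation_const] at hpath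
  rw [Real.sqrt_mul K.cast_nonneg]
  linarith

/-! ### The self-bounding regime -/

/-- `√(t + 1)` times the coefficient of `∑ i ≠ a, √(p i)` in the bound on the regret of a player in
the round after `t` rounds: `5 / 2` for stability, the rest for the growth of the regularizer. -/
noncomputable def rootMassCoeff (t : ℕ) : ℝ :=
  5 / 2 + 2 * √((t : ℝ) + 1) * (√((t : ℝ) + 1) - √(t : ℝ))

theorem rootMassCoeff_nonneg (t : ℕ) : 0 ≤ rootMassCoeff t := by
  have hd : 0 ≤ √((t : ℝ) + 1) - √(t : ℝ) :=
    sub_nonneg.2 (Real.sqrt_le_sqrt (by linarith))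
  unfold rootMassCoeff
  positivity

theorem rootMassCoeff_zero : rootMassCoeff 0 = 9 / 2 := by
  norm_num [rootMassCoeff]

theorem rootMassCoeff_succ_le (t : ℕ) : rootMassCoeff (t + 1) ≤ 4 := by
  have ht : (0 : ℝ) ≤ t := t.cast_nonneg
  unfold rootMassCoeff
  push_cast
  have h2 := Real.mul_self_sqrt (show (0 : ℝ) ≤ (t : ℝ) + 1 + 1 by positivity)
  have h3 : (t : ℝ) + 5 / 4 ≤ √((t : ℝ) + 1 + 1) * √((t : ℝ) + 1) := by
    rw [← Real.sqrt_mul (by positivity)]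
    exact Real.le_sqrt_of_sq_le (by nlinarith)
  linarith

theorem playerBound_shiftedStabilityBound_le {K : ℕ} {p : Fin K → ℝ} (a : Fin K) (t : ℕ)
    (hp : p ∈ stdSimplex ℝ (Fin K)) (hpos : ∀ j, 0 < p j) :
    playerBound (shiftedStabilityBound a) t p
      ≤ ∑ i ∈ Finset.univ.erase a, rootMassCoeff t / √((t : ℝ) + 1) * √(p i) := by
  have hν : 0 < √((t : ℝ) + 1) := Real.sqrt_pos.2 (by positivity)
  have hd : 0 ≤ √((t : ℝ) + 1) - √(t : ℝ) :=
    sub_nonneg.2 (Real.sqrt_le_sqrt (by linarith))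
  have hpa : √(p a) ≤ 1 := Real.sqrt_le_one.2
    (hp.2 ▸ Finset.single_le_sum (fun j _ => hp.1 j) (Finset.mem_univ a))
  have h1 := sum_mul_shiftedStabilityBound_le a t hp hpos
  have h2 : 2 * (√((t : ℝ) + 1) - √(t : ℝ)) * (∑ k, √(p k) - 1)
      ≤ 2 * (√((t : ℝ) + 1) - √(t : ℝ)) * ∑ i ∈ Finset.univ.erase a, √(p i) := by
    rw [← Finset.add_sum_erase _ _ (Finset.mem_univ a)]
    exact mul_le_mul_of_nonneg_left (by linarith) (by linarith)
  rw [← Finset.mul_sum, playerBound]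
  refine (add_le_add h1 h2).trans (le_of_eq ?_)
  unfold rootMassCoeff
  field_simp

/-- `A √p - p d / 2 ≤ A ^ 2 / (2 d)`, scaled: the self-bounding step for one arm in one round. -/
theorem root_sub_linear_le {A ν p d : ℝ} (hν : 0 < ν) (hp : 0 ≤ p) (hd : 0 < d) :
    A / ν * √p - 1 / 2 * (p * d) ≤ A ^ 2 / ν ^ 2 / (2 * d) := by
  have hpp := Real.sq_sqrt hp
  have h : A ^ 2 / ν ^ 2 / (2 * d) - (A / ν * √p - 1 / 2 * (√p ^ 2 * d))
      = (A / ν - √p * d) ^ 2 / (2 * d) := by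
    field_simp
    ring
  rw [hpp] at h
  have : 0 ≤ (A / ν - √p * d) ^ 2 / (2 * d) := by positivity
  linarith

theorem sum_rootMassCoeff_sq_le (T : ℕ) (hT : 1 ≤ T) :
    ∑ s : Fin T, rootMassCoeff s ^ 2 / ((s : ℝ) + 1) ≤ 16 * Real.log T + 48 := by
  rw [Fin.sum_univ_eq_sum_range (fun s => rootMassCoeff s ^ 2 / ((s : ℝ) + 1))]
  induction T, hT using Nat.le_induction with
  | base =>
    -- The first round exceeds the coefficient `4`; it is paid for by the constant `48`.
    rw [Finset.sum_range_one, rootMassCoeff_zero]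
    norm_num
  | succ T hT ih =>
    have hT0 : (0 : ℝ) < T := by exact_mod_cast hT
    rw [Finset.sum_range_succ]
    have hA : rootMassCoeff T ^ 2 ≤ 16 := by
      obtain ⟨t, rfl⟩ := Nat.exists_eq_add_of_le' hT
      nlinarith [rootMassCoeff_nonneg (t + 1), rootMassCoeff_succ_le t]
    have hlog := Real.one_sub_inv_le_log_of_pos (x := ((T : ℝ) + 1) / T) (by positivity)
    rw [Real.log_div (by positivity) hT0.ne'] at hlog
    have hinv : 1 - (((T : ℝ) + 1) / T)⁻¹ = 1 / ((T : ℝ) + 1) := by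
      field_simp
      ring
    rw [hinv] at hlog
    have hterm : rootMassCoeff T ^ 2 / ((T : ℝ) + 1) ≤ 16 * (1 / ((T : ℝ) + 1)) := by
      rw [mul_one_div]
      exact div_le_div_of_nonneg_right hA (by positivity)
    push_cast
    linarith

theorem rescaledDuelingRegret_le_log {K m : ℕ} [NeZero K] (hm : 2 ≤ m)
    (P : ℕ → PreferenceMatrix K) (a : Fin K) (T : ℕ) (hT : 1 ≤ T) (Δ : Fin K → ℝ)
    (hΔ : ∀ i, i ≠ a → 0 < Δ i) (hself : SelfBounding hm (versatileDB K) P a Δ T) :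
    expectation (metaLaw hm (versatileDB K) P T) (rescaledDuelingRegret P a)
      ≤ ∑ i ∈ Finset.univ.erase a, (16 * Real.log T + 48) / (beta m * Δ i) := by
  have h := two_mul_rescaledDuelingRegret_le hm P a T (isStabilityBound_shiftedStabilityBound a)
  unfold SelfBounding at hself
  rw [← expectation_const_mul] at hself
  have hpath : expectation (metaLaw hm (versatileDB K) P T) (fun h => ∑ s : Fin T,
        (playerBound (shiftedStabilityBound a) s
            (metaFirst (versatileDB K) s (Fin.take s s.isLt.le h)).1
          + playerBound (shiftedStabilityBound a) s
            (metaSecond (versatileDB K) s (Fin.take s s.isLt.le h)).1)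
        - 1 / 2 * weightedSuboptimalMass (versatileDB K) (fun i => beta m * Δ i) a h)
      ≤ expectation (metaLaw hm (versatileDB K) P T) fun _ =>
        ∑ i ∈ Finset.univ.erase a, (16 * Real.log T + 48) / (beta m * Δ i) := by
    refine expectation_mono _ fun h => ?_
    calc _ ≤ ∑ s : Fin T, ∑ i ∈ Finset.univ.erase a,
          rootMassCoeff s ^ 2 / ((s : ℝ) + 1) / (beta m * Δ i) := by
          rw [weightedSuboptimalMass, Finset.mul_sum, ← Finset.sum_sub_distrib]
          refine Finset.sum_le_sum fun s _ => ?_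
          rw [metaFirst_versatileDB, metaSecond_versatileDB]
          have hp := playerDist_mem s fun i => firstRecord (Fin.take s s.isLt.le h i)
          have hq := playerDist_mem s fun i => secondRecord (Fin.take s s.isLt.le h i)
          have h1 := playerBound_shiftedStabilityBound_le a s hp (playerDist_pos s _)
          have h2 := playerBound_shiftedStabilityBound_le a s hq (playerDist_pos s _)
          refine (sub_le_sub_right (add_le_add h1 h2) _).trans ?_
          rw [← Finset.sum_add_distrib, Finset.mul_sum, ← Finset.sum_sub_distrib]
          refine Finset.sum_le_sum fun i hi => ?_
          have hν : 0 < √((s : ℝ) + 1) := Real.sqrt_pos.2 (by positivity)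
          have hd := mul_pos (beta_pos hm) (hΔ i (Finset.ne_of_mem_erase hi))
          have h3 := root_sub_linear_le (A := rootMassCoeff s) hν (hp.1 i) hd
          have h4 := root_sub_linear_le (A := rootMassCoeff s) hν (hq.1 i) hd
          rw [Real.sq_sqrt (by positivity)] at h3 h4
          have h5 : rootMassCoeff s ^ 2 / ((s : ℝ) + 1) / (beta m * Δ i)
              = rootMassCoeff s ^ 2 / ((s : ℝ) + 1) / (2 * (beta m * Δ i))
                + rootMassCoeff s ^ 2 / ((s : ℝ) + 1) / (2 * (beta m * Δ i)) := by
            field_simp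
            norm_num
          rw [h5]
          linarith
      _ ≤ _ := by
          rw [Finset.sum_comm]
          refine Finset.sum_le_sum fun i hi => ?_
          rw [← Finset.sum_div]
          exact div_le_div_of_nonneg_right (sum_rootMassCoeff_sq_le T hT)
            (mul_pos (beta_pos hm) (hΔ i (Finset.ne_of_mem_erase hi))).le
  rw [expectation_const, expectation_sub] at hpath
  linarith

end MultiDueling

theorem theorem1 (K m T : ℕ) [NeZero K] (hm : 2 ≤ m) (hmK : m ≤ K) (hT : 1 ≤ T)
    (P : ℕ → MultiDueling.PreferenceMatrix K) (a : Fin K)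
    (ha : ∀ t < T, MultiDueling.IsCondorcetWinner (P t) a) :
    (MultiDueling.expectation
          (MultiDueling.metaLaw hm (MultiDueling.versatileDB K) P T)
          (MultiDueling.condorcetRegret P a)
        ≤ 1 / MultiDueling.beta m * (4 * Real.sqrt ((K : ℝ) * T) + 1)
      ∧ 1 / MultiDueling.beta m * (4 * Real.sqrt ((K : ℝ) * T) + 1)
        ≤ 8 * Real.sqrt ((K : ℝ) * T) + 2)
    ∧ ∀ Δ : Fin K → ℝ, (∀ i, i ≠ a → 0 < Δ i) →
        MultiDueling.SelfBounding hm (MultiDueling.versatileDB K) P a Δ T →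
        MultiDueling.expectation
            (MultiDueling.metaLaw hm (MultiDueling.versatileDB K) P T)
            (MultiDueling.condorcetRegret P a)
          ≤ 1 / MultiDueling.beta m ^ 2 *
              ∑ i ∈ Finset.univ.erase a, (16 * Real.log T + 48) / Δ i
            + (4 * Real.log T + 12) / MultiDueling.beta m
            + 8 * Real.sqrt K / MultiDueling.beta m := by
  have hβ := MultiDueling.beta_pos hm
  have hregret := MultiDueling.beta_mul_expectation_condorcetRegret hm
    (MultiDueling.versatileDB K) P a T
  set R := MultiDueling.expectation
    (MultiDueling.metaLaw hm (MultiDueling.versatileDB K) P T) (MultiDueling.condorcetRegret P a)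
  refine ⟨⟨?_, ?_⟩, fun Δ hΔ hself => ?_⟩
  · have h := MultiDueling.rescaledDuelingRegret_le_sqrt hm P a T
    rw [← hregret] at h
    rw [one_div_mul_eq_div, le_div_iff₀ hβ]
    linarith
  · have h : 1 / MultiDueling.beta m ≤ 2 := by
      rw [div_le_iff₀ hβ]
      linarith [MultiDueling.half_le_beta hm]
    have h2 := mul_le_mul_of_nonneg_right h
      (show 0 ≤ 4 * Real.sqrt ((K : ℝ) * T) + 1 by positivity)
    linarith
  · have h := MultiDueling.rescaledDuelingRegret_le_log hm P a T hT Δ hΔ hself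
    rw [← hregret] at h
    have hlog : 0 ≤ Real.log T := Real.log_nonneg (by exact_mod_cast hT)
    have hsum : 1 / MultiDueling.beta m ^ 2 *
          ∑ i ∈ Finset.univ.erase a, (16 * Real.log T + 48) / Δ i
        = (∑ i ∈ Finset.univ.erase a,
            (16 * Real.log T + 48) / (MultiDueling.beta m * Δ i)) / MultiDueling.beta m := by
      rw [Finset.mul_sum, Finset.sum_div]
      refine Finset.sum_congr rfl fun i hi => ?_
      have := (hΔ i (Finset.ne_of_mem_erase hi)).ne'
      field_simp
    have h1 : R ≤ (∑ i ∈ Finset.univ.erase a,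
        (16 * Real.log T + 48) / (MultiDueling.beta m * Δ i)) / MultiDueling.beta m := by
      rw [le_div_iff₀ hβ]
      linarith
    -- The sum over the arms alone is a bound; the other two terms of the claim are nonnegative.
    have h2 : 0 ≤ (4 * Real.log T + 12) / MultiDueling.beta m := by positivity
    have h3 : 0 ≤ 8 * Real.sqrt K / MultiDueling.beta m := by positivity
    rw [hsum]
    linarith
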